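/- **Theorem 3 (marginal posterior consistency).** Let $\gamma>0$, $0<k_1\le 1$, $k_2\ge 2$ and $\rho\in(0,1)$ be fixed. For each $n$ let $X_n$ be a real $n\times p_n$ matrix and $\beta_n^0\in\mathbb R^{p_n}$, and let the observation $y_n\in\mathbb R^n$ have law $F_{\beta_n^0}=\mathrm N(X_n\beta_n^0,\gamma^{-1}I_n)$; all $y_n$ are defined on one probability space, with arbitrary joint law. Let $C_n>0$ be real numbers. *Model.* Given $\beta_n$ and the known precision $\gamma$, $y_n\sim \mathrm N(X_n\beta_n,\gamma^{-1}I_n)$. Given $\theta_n=(\lambda_n,\alpha_n,\kappa_n)$, with $\lambda_n=(\lambda_{n1},\dots,\lambda_{np_n})$, the coefficient vector $\beta_n\in\mathbb R^{p_n}$ has prior density $$\nu(\beta_n\mid\gamma,\lambda_n,\alpha_n)=\Big(\frac{\alpha_n\gamma^{1/\alpha_n}}{2^{1/\alpha_n+1}\Gamma(1/\alpha_n)}\Big)^{p_n}\Big(\prod_{j=1}^{p_n}\lambda_{nj}\Big)^{1/\alpha_n}\exp\Big\{-\frac{\gamma}{2}\sum_{j=1}^{p_n}\lambda_{nj}|\beta_{nj}|^{\alpha_n}\Big\}.$$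 Here $\alpha_n\sim\mathrm{Unif}(k_1,k_2)$, the $\kappa_{nj}$ are i.i.d. $\mathrm{Bern}(1/2)$ and independent of $\alpha_n$, and $$\lambda_{nj}=\big(C_n\sqrt{p_n}\,n^{\rho/2}\log n\big)^{\alpha_n},\qquad j=1,\dots,p_n .$$ Let $Q_n(\cdot\mid y_n)$ be the marginal posterior distribution of $\beta_n$ given $y_n$, that is, the posterior of $(\beta_n,\theta_n)$ with $\theta_n$ integrated out. *Assumptions.* As $n\to\infty$: 1. $p_n=o(n)$; 2. if $\Lambda_{n\min}$ and $\Lambda_{n\max}$ are the smallest and largest singular values of $X_n$, there are constants with $0<\Lambda_{\min}<\liminf_n \Lambda_{n\min}/\sqrt n\le\limsup_n\Lambda_{n\max}/\sqrt n<\Lambda_{\max}<\infty$; 3. $\sup_n\max_{1\le j\le p_n}|\beta^0_{nj}|<\infty$; 4. the number $m_n$ of nonzero entries of $\beta_n^0$ satisfies $m_n=o\{n^{1-\rho}/(p_n\log^2 n)\}$; 5. $C_n^2=o(n)$. *Conclusion.* For every $\epsilon>0$, as $n\to\infty$, $$Q_n\big(\{\beta_n:\|\beta_n-\beta_n^0\|>\epsilon\}\mid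 y_n\big)\to 0\qquad\text{almost surely},$$ where $\|\cdot\|$ is the Euclidean norm. -/

import Mathlib

open MeasureTheory ProbabilityTheory Filter Asymptotics
open scoped Topology ENNReal

namespace BayesPenalized

/-- The `k`-dimensional Euclidean space. -/
abbrev E (k : ℕ) : Type := EuclideanSpace ℝ (Fin k)

noncomputable section

/-- The mean `X β` of the response, with the Euclidean structure on both sides. -/
def mean {n p : ℕ} (X : Matrix (Fin n) (Fin p) ℝ) (β : E p) : E n :=
  Matrix.toEuclideanLin X β

/-- The sampling distribution `N(X β, γ⁻¹ I_n)` of the response. -/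
def dataLaw {n p : ℕ} (X : Matrix (Fin n) (Fin p) ℝ) (γ : ℝ) (β : E p) : Measure (E n) :=
  multivariateGaussian (mean X β) (γ⁻¹ • (1 : Matrix (Fin n) (Fin n) ℝ))

/-- The likelihood: the Lebesgue density of `N(X β, γ⁻¹ I_n)` at `y`. -/
def likelihood {n p : ℕ} (X : Matrix (Fin n) (Fin p) ℝ) (γ : ℝ) (y : E n) (β : E p) : ℝ :=
  (γ / (2 * Real.pi)) ^ ((n : ℝ) / 2) * Real.exp (-(γ / 2) * ‖y - mean X β‖ ^ 2)

/-- The conditional prior density `ν(β | γ, λ, α)` of the regression coefficients. -/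
def coefPriorDensity {p : ℕ} (γ : ℝ) (lam : Fin p → ℝ) (α : ℝ) (β : E p) : ℝ :=
  (α * γ ^ (1 / α) / (2 ^ (1 / α + 1) * Real.Gamma (1 / α))) ^ p *
    (∏ i, lam i) ^ (1 / α) *
    Real.exp (-(γ / 2) * ∑ i, lam i * |β i| ^ α)

/-- The parameters `θ = (λ, α, κ)`; `κ i` is the indicator (a `Bool`) of the mixture component
attached to the `i`-th coefficient. -/
abbrev Theta (p : ℕ) : Type := (Fin p → ℝ) × ℝ × (Fin p → Bool)

/-- The prior of `θ = (λ, α, κ)` when `α ~ Unif(k₁, k₂)`, the `κ i` are independent `Bern(1/2)`,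
independent of `α`, and every `λ i` equals `L ^ α`. -/
def thetaPrior (p : ℕ) (k₁ k₂ L : ℝ) : Measure (Theta p) :=
  ((cond volume (Set.Icc k₁ k₂) : Measure ℝ).prod
      (Measure.pi fun _ : Fin p => (PMF.uniformOfFintype Bool).toMeasure)).map
    fun ακ => (fun _ => L ^ ακ.1, ακ.1, ακ.2)

/-- The joint prior `ν(dβ | θ) ν(dθ)` of `(β, θ)`. -/
def jointPrior (p : ℕ) (γ k₁ k₂ L : ℝ) : Measure (E p × Theta p) :=
  ((volume : Measure (E p)).prod (thetaPrior p k₁ k₂ L)).withDensity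
    fun q => ENNReal.ofReal (coefPriorDensity γ q.2.1 q.2.2.1 q.1)

/-- The full posterior distribution of `(β, θ)` given `y`: by Bayes' formula, the joint prior
weighted by the likelihood and normalized by the marginal density of `y`. -/
def jointPosterior {n p : ℕ} (X : Matrix (Fin n) (Fin p) ℝ) (γ k₁ k₂ L : ℝ) (y : E n) :
    Measure (E p × Theta p) :=
  (∫⁻ q, ENNReal.ofReal (likelihood X γ y q.1) ∂jointPrior p γ k₁ k₂ L)⁻¹ •
    (jointPrior p γ k₁ k₂ L).withDensity fun q => ENNReal.ofReal (likelihood X γ y q.1)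

/-- The marginal posterior distribution of `β` given `y`. -/
def marginalPosterior {n p : ℕ} (X : Matrix (Fin n) (Fin p) ℝ) (γ k₁ k₂ L : ℝ) (y : E n) :
    Measure (E p) :=
  (jointPosterior X γ k₁ k₂ L y).map Prod.fst

/-- The largest singular value of `X`. -/
def sigmaMax {n p : ℕ} (X : Matrix (Fin n) (Fin p) ℝ) : ℝ :=
  (Matrix.toEuclideanLin X).singularValues 0

/-- The smallest of the `min n p` singular values of `X`
(Mathlib lists the singular values in decreasing order, starting at index `0`). -/
def sigmaMin {n p : ℕ} (X : Matrix (Fin n) (Fin p) ℝ) : ℝ :=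
  (Matrix.toEuclideanLin X).singularValues (min n p - 1)

/-- The number of nonzero coordinates of `β`. -/
def numNonzero {p : ℕ} (β : E p) : ℕ :=
  Nat.card {j : Fin p // β j ≠ 0}

end

end BayesPenalized

namespace BayesPenalized

/-! The posterior mass of `{ε < ‖β - β₀‖}` is a ratio of integrals of prior times likelihood. The
denominator is bounded below on a small box around `β₀` with exponents `α` just above `k₁`; the
numerator is bounded above pointwise (`marginalPosterior_le`). Writing `β = β₀ + h`, both bounds
contain the same factor, the likelihood at `β₀` times `L ^ p` times the exponential of the
`k₁`-penalty of `β₀`, and it cancels.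

In the numerator the likelihood contributes `‖X h‖ ^ 2 ≥ s ‖h‖ ^ 2` with `s` of order `n`, against a
linear term controlled by the score. Any penalty with `α ≥ k₁` dominates the `k₁`-penalty up to an
additive `p`. Since `k₁ ≤ 1` that penalty is subadditive, so moving from `β₀` to `β₀ + h` gains the
penalty of `h` and loses only a term carried by the support of `β₀` (`le_powPenalty_add`), which
sparsity makes `o(n)`.

Integrating over `h` costs `(I / T) ^ p` against the box volume `(2 / T) ^ p`, where `T = max L √n`:
the scale cancels, however large `L` is. What remains is `R ^ p * exp (γ τ - γ s ε ^ 2 / 8) / δ` up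
to a constant (`exists_marginalPosterior_bound`). Gaussian concentration and Borel–Cantelli give `τ
≤ η n` almost surely, `p = o(n)` tames `R ^ p`, and `1 / δ` is polynomial in `n`. -/

/-! ### Singular values and the design matrix. -/

theorem sq_norm_mean_eq_sum {n p : ℕ} (X : Matrix (Fin n) (Fin p) ℝ) (h : E p) :
    ∃ b : OrthonormalBasis (Fin p) ℝ (E p),
      ‖mean X h‖ ^ 2 =
        ∑ i : Fin p, (Matrix.toEuclideanLin X).singularValues i ^ 2 * (inner ℝ (b i) h) ^ 2 := by
  have hn : Module.finrank ℝ (E p) = p := by simp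
  set T := Matrix.toEuclideanLin X
  have hT := T.isSymmetric_adjoint_comp_self
  -- An eigenbasis of `XᵀX` diagonalizes the quadratic form, with the squared singular values as
  -- coefficients.
  refine ⟨hT.eigenvectorBasis hn, ?_⟩
  have h1 : ‖mean X h‖ ^ 2 = inner ℝ ((LinearMap.adjoint T ∘ₗ T) h) h := by
    rw [LinearMap.comp_apply, LinearMap.adjoint_inner_left, real_inner_self_eq_norm_sq]
    rfl
  rw [h1, ← OrthonormalBasis.sum_inner_mul_inner (hT.eigenvectorBasis hn)]
  refine Finset.sum_congr rfl fun i _ => ?_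
  rw [hT, hT.apply_eigenvectorBasis hn, real_inner_comm, inner_smul_left,
    LinearMap.sq_singularValues_fin T hn i, real_inner_comm]
  simp
  ring

theorem norm_mean_le {n p : ℕ} (X : Matrix (Fin n) (Fin p) ℝ) (h : E p) :
    ‖mean X h‖ ≤ sigmaMax X * ‖h‖ := by
  obtain ⟨b, hb⟩ := sq_norm_mean_eq_sum X h
  have h0 : 0 ≤ sigmaMax X := LinearMap.singularValues_nonneg _ _
  refine le_of_sq_le_sq ?_ (by positivity)
  rw [hb, mul_pow, ← b.sum_sq_inner_right h, Finset.mul_sum]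
  refine Finset.sum_le_sum fun i _ => ?_
  gcongr
  · exact LinearMap.singularValues_nonneg _ _
  · exact LinearMap.singularValues_antitone _ (Nat.zero_le _)

theorem le_norm_mean {n p : ℕ} (hpn : p ≤ n) (X : Matrix (Fin n) (Fin p) ℝ) (h : E p) :
    sigmaMin X * ‖h‖ ≤ ‖mean X h‖ := by
  obtain ⟨b, hb⟩ := sq_norm_mean_eq_sum X h
  have h0 : 0 ≤ sigmaMin X := LinearMap.singularValues_nonneg _ _
  refine le_of_sq_le_sq ?_ (by positivity)
  rw [hb, mul_pow, ← b.sum_sq_inner_right h, Finset.mul_sum]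
  refine Finset.sum_le_sum fun i _ => ?_
  gcongr
  -- `p ≤ n` makes `min n p - 1` the last of the `p` indices; for `p > n` the kernel of `X` would
  -- break the bound.
  exact LinearMap.singularValues_antitone _ (by have := i.2; omega)

/-! ### Gaussian concentration of the score. -/

/-- The score `Xᵀ (y - X β)` of the Gaussian linear model, up to the factor `γ`. -/
noncomputable def score {n p : ℕ} (X : Matrix (Fin n) (Fin p) ℝ) (β : E p) (y : E n) : E p :=
  LinearMap.adjoint (Matrix.toEuclideanLin X) (y - mean X β)

theorem inner_score {n p : ℕ} (X : Matrix (Fin n) (Fin p) ℝ) (β : E p) (y : E n) (h : E p) :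
    inner ℝ (score X β y) h = inner ℝ (y - mean X β) (mean X h) := by
  rw [score, LinearMap.adjoint_inner_left]
  rfl

theorem continuous_score {n p : ℕ} (X : Matrix (Fin n) (Fin p) ℝ) (β : E p) :
    Continuous (score X β) := by
  unfold score
  exact (LinearMap.continuous_of_finiteDimensional _).comp (by fun_prop)

theorem lintegral_exp_inner_dataLaw {n p : ℕ} (X : Matrix (Fin n) (Fin p) ℝ) {γ : ℝ} (hγ : 0 < γ)
    (β : E p) (v : E n) :
    ∫⁻ y, ENNReal.ofReal (Real.exp (inner ℝ (y - mean X β) v)) ∂dataLaw X γ β =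
      ENNReal.ofReal (Real.exp (‖v‖ ^ 2 / (2 * γ))) := by
  have hS : (γ⁻¹ • (1 : Matrix (Fin n) (Fin n) ℝ)).PosSemidef :=
    Matrix.PosSemidef.one.smul (by positivity)
  have : IsGaussian (dataLaw X γ β) := isGaussian_multivariateGaussian
  have hmap := IsGaussian.map_eq_gaussianReal (μ := dataLaw X γ β) (innerSL ℝ v)
  have hmean : ∫ x, innerSL ℝ v x ∂dataLaw X γ β = inner ℝ v (mean X β) := by
    rw [ContinuousLinearMap.integral_comp_id_comm IsGaussian.integrable_id, dataLaw,
      integral_id_multivariateGaussian]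
    rfl
  have hvar : Var[innerSL ℝ v; dataLaw X γ β] = γ⁻¹ * ‖v‖ ^ 2 := by
    have h1 := covarianceBilin_self (μ := dataLaw X γ β) IsGaussian.memLp_two_id v
    have h2 : (innerSL ℝ v : E n → ℝ) = fun u => inner ℝ v u := by ext; simp
    rw [h2, ← h1, dataLaw, covarianceBilin_multivariateGaussian hS, Matrix.smul_mulVec,
      Matrix.one_mulVec, dotProduct_smul, smul_eq_mul, EuclideanSpace.real_norm_sq_eq]
    simp [dotProduct, sq]
  have hmgf := mgf_gaussianReal hmap 1
  have hInt : Integrable (fun y => Real.exp (inner ℝ v y)) (dataLaw X γ β) := by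
    have h := integrable_exp_mul_gaussianReal
      (μ := ∫ x, innerSL ℝ v x ∂dataLaw X γ β)
      (v := (Var[innerSL ℝ v; dataLaw X γ β]).toNNReal) 1
    rw [← hmap, integrable_map_measure (by fun_prop) (by fun_prop)] at h
    refine h.congr (ae_of_all _ fun y => ?_)
    simp
  have hval : ∫ y, Real.exp (inner ℝ v y) ∂dataLaw X γ β =
      Real.exp (inner ℝ v (mean X β) + ‖v‖ ^ 2 / (2 * γ)) := by
    rw [mgf, hmean, hvar, Real.coe_toNNReal _ (by positivity)] at hmgf
    simp only [one_mul, innerSL_apply_apply] at hmgf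
    rw [hmgf]
    congr 1
    field_simp
  have hsplit : ∀ y, Real.exp (inner ℝ (y - mean X β) v) =
      Real.exp (-inner ℝ v (mean X β)) * Real.exp (inner ℝ v y) := fun y => by
    rw [← Real.exp_add, real_inner_comm, inner_sub_right]
    congr 1
    ring
  simp_rw [hsplit]
  rw [← ofReal_integral_eq_lintegral_ofReal (hInt.const_mul _)
    (ae_of_all _ fun y => by positivity), integral_const_mul, hval, ← Real.exp_add]
  congr 2
  ring

theorem lintegral_exp_neg_sq_norm_add {p : ℕ} {b : ℝ} (hb : 0 < b) (c : ℝ) (w : E p) :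
    ∫⁻ h : E p, ENNReal.ofReal (Real.exp (-b * ‖h‖ ^ 2 + c * inner ℝ w h)) =
      ENNReal.ofReal ((Real.pi / b) ^ ((p : ℝ) / 2) * Real.exp (c ^ 2 * ‖w‖ ^ 2 / (4 * b))) := by
  have hb' : 0 < (b : ℂ).re := by simpa
  have hcast : ∀ h : E p, Complex.exp (-(b : ℂ) * (‖h‖ : ℂ) ^ 2 + (c : ℂ) * (inner ℝ w h : ℝ)) =
      ((Real.exp (-b * ‖h‖ ^ 2 + c * inner ℝ w h) : ℝ) : ℂ) := fun h => by push_cast; rfl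
  have hInt := GaussianFourier.integrable_cexp_neg_mul_sq_norm_add (V := E p) hb' (c : ℂ) w
  have hval := GaussianFourier.integral_cexp_neg_mul_sq_norm_add (V := E p) hb' (c : ℂ) w
  simp_rw [hcast] at hInt hval
  rw [integral_complex_ofReal] at hval
  have hInt' : Integrable (fun h : E p => Real.exp (-b * ‖h‖ ^ 2 + c * inner ℝ w h)) := by
    refine hInt.re.congr (ae_of_all _ fun h => ?_)
    exact Complex.ofReal_re _
  rw [← ofReal_integral_eq_lintegral_ofReal hInt' (ae_of_all _ fun y => by positivity)]
  congr 1
  have hpos : (0 : ℝ) ≤ Real.pi / b := by positivity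
  have hfin : Module.finrank ℝ (E p) = p := by simp
  rw [hfin] at hval
  apply Complex.ofReal_injective
  rw [hval]
  push_cast [Complex.ofReal_cpow hpos]
  rfl

/-- Exponentials of squares are linearized: `exp (c² ‖w‖² / 4)` is, up to `π ^ (p/2)`, the integral
over `h` of `exp (-‖h‖² + c ⟪w, h⟫)`. After Fubini only the moment generating function of a linear
functional of `y` is needed. -/
theorem lintegral_exp_sq_norm_score_le {n p : ℕ} (X : Matrix (Fin n) (Fin p) ℝ) {γ S : ℝ}
    (hγ : 0 < γ) (hS : 0 < S) (hX : ∀ h, ‖mean X h‖ ≤ S * ‖h‖) (β : E p) :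
    ∫⁻ y, ENNReal.ofReal (Real.exp (γ / (4 * S ^ 2) * ‖score X β y‖ ^ 2)) ∂dataLaw X γ β ≤
      ENNReal.ofReal (2 ^ ((p : ℝ) / 2)) := by
  have : IsGaussian (dataLaw X γ β) := isGaussian_multivariateGaussian
  have : IsProbabilityMeasure (dataLaw X γ β) := inferInstance
  -- With this `c` the integral over `y` returns at most `exp (‖h‖² / 2)`, half of the Gaussian
  -- weight; the ratio of the two Gaussian integrals is `2 ^ (p/2)`.
  set c : ℝ := √γ / S
  have hc : c ^ 2 = γ / S ^ 2 := by rw [div_pow, Real.sq_sqrt hγ.le]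
  have hπ : (0 : ℝ) < Real.pi ^ ((p : ℝ) / 2) := by positivity
  have hleft : ∀ y, ENNReal.ofReal (Real.pi ^ ((p : ℝ) / 2)) *
      ENNReal.ofReal (Real.exp (γ / (4 * S ^ 2) * ‖score X β y‖ ^ 2)) =
      ∫⁻ h : E p, ENNReal.ofReal (Real.exp (-1 * ‖h‖ ^ 2 + c * inner ℝ (score X β y) h)) :=
    fun y => by
    rw [lintegral_exp_neg_sq_norm_add one_pos, ← ENNReal.ofReal_mul hπ.le, div_one, hc]
    congr 3
    field_simp
  have hinner : ∀ h : E p,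
      ∫⁻ y, ENNReal.ofReal (Real.exp (-1 * ‖h‖ ^ 2 + c * inner ℝ (score X β y) h)) ∂dataLaw X γ β ≤
      ENNReal.ofReal (Real.exp (-(1 / 2) * ‖h‖ ^ 2 + 0 * inner ℝ (0 : E p) h)) := fun h => by
    have h1 : ∀ y, ENNReal.ofReal (Real.exp (-1 * ‖h‖ ^ 2 + c * inner ℝ (score X β y) h)) =
        ENNReal.ofReal (Real.exp (-1 * ‖h‖ ^ 2)) *
          ENNReal.ofReal (Real.exp (inner ℝ (y - mean X β) (c • mean X h))) := fun y => by
      rw [← ENNReal.ofReal_mul (by positivity), ← Real.exp_add, inner_score, inner_smul_right]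
    simp_rw [h1]
    rw [lintegral_const_mul _ (by fun_prop), lintegral_exp_inner_dataLaw X hγ,
      ← ENNReal.ofReal_mul (by positivity), ← Real.exp_add]
    apply ENNReal.ofReal_le_ofReal
    apply Real.exp_le_exp.2
    have h2 : ‖c • mean X h‖ ^ 2 / (2 * γ) ≤ 1 / 2 * ‖h‖ ^ 2 := by
      rw [norm_smul, mul_pow, Real.norm_eq_abs, sq_abs, hc]
      have h3 : ‖mean X h‖ ^ 2 ≤ S ^ 2 * ‖h‖ ^ 2 := by
        rw [← mul_pow]
        exact pow_le_pow_left₀ (norm_nonneg _) (hX h) 2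
      have h4 : γ / S ^ 2 * ‖mean X h‖ ^ 2 / (2 * γ) = 1 / 2 * (‖mean X h‖ ^ 2 / S ^ 2) := by
        field_simp
      rw [h4]
      gcongr
      rw [div_le_iff₀ (by positivity)]
      linarith
    linarith
  have hmeas : Measurable (Function.uncurry fun (y : E n) (h : E p) =>
      ENNReal.ofReal (Real.exp (-1 * ‖h‖ ^ 2 + c * inner ℝ (score X β y) h))) := by
    have := continuous_score X β
    refine ENNReal.measurable_ofReal.comp (Continuous.measurable ?_)
    fun_prop
  have key : ENNReal.ofReal (Real.pi ^ ((p : ℝ) / 2)) *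
      ∫⁻ y, ENNReal.ofReal (Real.exp (γ / (4 * S ^ 2) * ‖score X β y‖ ^ 2)) ∂dataLaw X γ β ≤
      ENNReal.ofReal (Real.pi ^ ((p : ℝ) / 2)) * ENNReal.ofReal (2 ^ ((p : ℝ) / 2)) := by
    have hm : Measurable fun y =>
        ENNReal.ofReal (Real.exp (γ / (4 * S ^ 2) * ‖score X β y‖ ^ 2)) := by
      have := continuous_score X β
      refine ENNReal.measurable_ofReal.comp (Continuous.measurable ?_)
      fun_prop
    rw [← lintegral_const_mul _ hm]
    simp_rw [hleft]
    rw [lintegral_lintegral_swap hmeas.aemeasurable]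
    refine (lintegral_mono hinner).trans ?_
    rw [lintegral_exp_neg_sq_norm_add (by norm_num), ← ENNReal.ofReal_mul hπ.le]
    apply ENNReal.ofReal_le_ofReal
    simp only [norm_zero]
    rw [← Real.mul_rpow Real.pi_pos.le (by norm_num)]
    have hdiv : Real.pi / (1 / 2) = Real.pi * 2 := by ring
    rw [hdiv]
    simp
  exact (ENNReal.mul_le_mul_iff_right (by simpa using hπ) ENNReal.ofReal_ne_top).1 key

/-- Gaussian concentration of the score. -/
theorem dataLaw_norm_score_gt_le {n p : ℕ} (X : Matrix (Fin n) (Fin p) ℝ) {γ S : ℝ}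
    (hγ : 0 < γ) (hS : 0 < S) (hX : ∀ h, ‖mean X h‖ ≤ S * ‖h‖) (β : E p) {t : ℝ} (ht : 0 ≤ t) :
    dataLaw X γ β {y | t < ‖score X β y‖} ≤
      ENNReal.ofReal (2 ^ ((p : ℝ) / 2) * Real.exp (-(γ / (4 * S ^ 2) * t ^ 2))) := by
  set a := Real.exp (γ / (4 * S ^ 2) * t ^ 2) with ha
  have ha0 : 0 < a := Real.exp_pos _
  have hm : Measurable fun y =>
      ENNReal.ofReal (Real.exp (γ / (4 * S ^ 2) * ‖score X β y‖ ^ 2)) := by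
    have := continuous_score X β
    refine ENNReal.measurable_ofReal.comp (Continuous.measurable ?_)
    fun_prop
  have h1 := mul_meas_ge_le_lintegral (μ := dataLaw X γ β) hm (ENNReal.ofReal a)
  have h2 := h1.trans (lintegral_exp_sq_norm_score_le X hγ hS hX β)
  have hsub : {y | t < ‖score X β y‖} ⊆ {y | ENNReal.ofReal a ≤
      ENNReal.ofReal (Real.exp (γ / (4 * S ^ 2) * ‖score X β y‖ ^ 2))} := fun y hy => by
    simp only [Set.mem_ofPred_eq] at hy ⊢
    apply ENNReal.ofReal_le_ofReal
    apply Real.exp_le_exp.2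
    gcongr
  rw [Real.exp_neg, ← ha, ENNReal.ofReal_mul (by positivity), ENNReal.ofReal_inv_of_pos ha0,
    ← div_eq_mul_inv, ENNReal.le_div_iff_mul_le (by simp [ha0]) (by simp), mul_comm]
  exact (mul_le_mul_right (measure_mono hsub) _).trans h2

/-! ### Measurability and the prior of the hyperparameters. -/

/-- Gamma is continuous off the countable set of its poles, and every function on a countable set is
measurable. -/
theorem measurable_Gamma : Measurable Real.Gamma := by
  set N : Set ℝ := Set.range fun m : ℕ => -(m : ℝ)
  have hN : N.Countable := Set.countable_range _
  refine measurable_of_restrict_of_restrict_compl hN.measurableSet ?_ ?_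
  · have : Countable N := hN
    exact measurable_of_countable _
  · refine (continuousOn_iff_continuous_domRestrict.1 fun s hs => ?_).measurable
    refine (Real.differentiableAt_Gamma fun m hm => hs ⟨m, hm.symm⟩).continuousAt.continuousWithinAt

theorem measurable_coefPriorDensity {p : ℕ} (γ : ℝ) :
    Measurable fun q : E p × Theta p => coefPriorDensity γ q.2.1 q.2.2.1 q.1 := by
  unfold coefPriorDensity
  have hΓ : Measurable fun q : E p × Theta p => Real.Gamma (1 / q.2.2.1) :=
    measurable_Gamma.comp (by fun_prop)
  have hα : Measurable fun q : E p × Theta p => 1 / q.2.2.1 := by fun_prop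
  have hlam : ∀ i, Measurable fun q : E p × Theta p => q.2.1 i := fun i => by fun_prop
  have hβ : ∀ i, Measurable fun q : E p × Theta p => |q.1 i| := fun i => by fun_prop
  have hprod : Measurable fun q : E p × Theta p => ∏ i, q.2.1 i :=
    Finset.measurable_prod _ fun i _ => hlam i
  have hsum : Measurable fun q : E p × Theta p => ∑ i, q.2.1 i * |q.1 i| ^ q.2.2.1 :=
    Finset.measurable_sum _ fun i _ => (hlam i).mul ((hβ i).pow (by fun_prop))
  have h2 : Measurable fun q : E p × Theta p => (2 : ℝ) ^ (1 / q.2.2.1 + 1) :=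
    measurable_const.pow (by fun_prop)
  have h1 : Measurable fun q : E p × Theta p => γ ^ (1 / q.2.2.1) := measurable_const.pow hα
  exact (((((by fun_prop : Measurable fun q : E p × Theta p => q.2.2.1).mul h1).div
    (h2.mul hΓ)).pow_const p).mul (hprod.pow hα)).mul (by fun_prop)

theorem continuous_likelihood {n p : ℕ} (X : Matrix (Fin n) (Fin p) ℝ) (γ : ℝ) (y : E n) :
    Continuous (likelihood X γ y) := by
  have h : Continuous (mean X) := (Matrix.toEuclideanLin X).continuous_of_finiteDimensional
  unfold likelihood
  fun_prop

section ThetaPrior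

variable {p : ℕ} {k₁ k₂ : ℝ} (L : ℝ)

theorem measurable_thetaOfAlpha :
    Measurable fun ακ : ℝ × (Fin p → Bool) =>
      ((fun _ => L ^ ακ.1, ακ.1, ακ.2) : Theta p) := by
  refine Measurable.prodMk (measurable_pi_lambda _ fun _ => measurable_const.pow measurable_fst) ?_
  fun_prop

theorem isProbabilityMeasure_condIcc (hk : k₁ < k₂) :
    IsProbabilityMeasure (cond volume (Set.Icc k₁ k₂) : Measure ℝ) :=
  cond_isProbabilityMeasure_of_finite (by simpa using hk) (by simp)

theorem isProbabilityMeasure_thetaPrior (hk : k₁ < k₂) :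
    IsProbabilityMeasure (thetaPrior p k₁ k₂ L) := by
  have := isProbabilityMeasure_condIcc hk
  exact Measure.isProbabilityMeasure_map (measurable_thetaOfAlpha L).aemeasurable

theorem measurableSet_thetaIcc (a b : ℝ) :
    MeasurableSet {θ : Theta p | θ.2.1 ∈ Set.Icc a b ∧ θ.1 = fun _ => L ^ θ.2.1} := by
  refine ((by fun_prop : Measurable fun θ : Theta p => θ.2.1) measurableSet_Icc).inter ?_
  exact measurableSet_eq_fun measurable_fst
    (measurable_pi_lambda _ fun _ => measurable_const.pow (by fun_prop))

theorem thetaPrior_thetaIcc (hk : k₁ < k₂) {δ : ℝ} (hδk : k₁ + δ ≤ k₂) :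
    thetaPrior p k₁ k₂ L {θ | θ.2.1 ∈ Set.Icc k₁ (k₁ + δ) ∧ θ.1 = fun _ => L ^ θ.2.1} =
      ENNReal.ofReal (δ / (k₂ - k₁)) := by
  have := isProbabilityMeasure_condIcc hk
  rw [thetaPrior, Measure.map_apply (measurable_thetaOfAlpha L) (measurableSet_thetaIcc L _ _)]
  have hpre : ((fun ακ : ℝ × (Fin p → Bool) => ((fun _ => L ^ ακ.1, ακ.1, ακ.2) : Theta p)) ⁻¹'
      {θ | θ.2.1 ∈ Set.Icc k₁ (k₁ + δ) ∧ θ.1 = fun _ => L ^ θ.2.1}) =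
      Set.Icc k₁ (k₁ + δ) ×ˢ Set.univ := by
    ext ακ
    simp
  rw [hpre, Measure.prod_prod, measure_univ, mul_one, cond_apply measurableSet_Icc,
    Set.inter_eq_self_of_subset_right (Set.Icc_subset_Icc_right hδk), Real.volume_Icc,
    Real.volume_Icc, ← ENNReal.ofReal_inv_of_pos (by linarith),
    ← ENNReal.ofReal_mul (inv_nonneg.2 (by linarith))]
  congr 1
  rw [add_sub_cancel_left, div_eq_inv_mul]

theorem ae_thetaPrior (hk : k₁ < k₂) :
    ∀ᵐ θ ∂thetaPrior p k₁ k₂ L, θ.2.1 ∈ Set.Icc k₁ k₂ ∧ θ.1 = fun _ => L ^ θ.2.1 := by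
  have := isProbabilityMeasure_thetaPrior (p := p) L hk
  have h := thetaPrior_thetaIcc (p := p) L hk (δ := k₂ - k₁) (by linarith)
  rw [add_sub_cancel, div_self (by linarith : k₂ - k₁ ≠ 0), ENNReal.ofReal_one] at h
  exact (prob_compl_eq_zero_iff (measurableSet_thetaIcc L _ _)).2 h

end ThetaPrior

/-! ### The posterior as a ratio of integrals. -/

/-- A bound of the posterior probability of `A` by an upper bound of the integrand over `A` and
a lower bound of the integrand over a set `B` and a range of small exponents. -/
theorem marginalPosterior_le {n p : ℕ} (X : Matrix (Fin n) (Fin p) ℝ) {γ k₁ k₂ L δ : ℝ} (y : E n)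
    (hk : k₁ < k₂) (hδk : k₁ + δ ≤ k₂) {A B : Set (E p)}
    (hA : MeasurableSet A) (hB : MeasurableSet B) {F : E p → ℝ≥0∞} {G : ℝ≥0∞}
    (hF : ∀ β ∈ A, ∀ α ∈ Set.Icc k₁ k₂,
      ENNReal.ofReal (coefPriorDensity γ (fun _ => L ^ α) α β) *
        ENNReal.ofReal (likelihood X γ y β) ≤ F β)
    (hFm : Measurable F)
    (hG : ∀ β ∈ B, ∀ α ∈ Set.Icc k₁ (k₁ + δ),
      G ≤ ENNReal.ofReal (coefPriorDensity γ (fun _ => L ^ α) α β) *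
        ENNReal.ofReal (likelihood X γ y β)) :
    marginalPosterior X γ k₁ k₂ L y A ≤
      (G * (volume B * ENNReal.ofReal (δ / (k₂ - k₁))))⁻¹ * ∫⁻ β in A, F β := by
  have := isProbabilityMeasure_thetaPrior (p := p) L hk
  set θp := thetaPrior p k₁ k₂ L
  set μ := (volume : Measure (E p)).prod θp with hμ
  have hd : Measurable fun q : E p × Theta p =>
      ENNReal.ofReal (coefPriorDensity γ q.2.1 q.2.2.1 q.1) :=
    (measurable_coefPriorDensity γ).ennreal_ofReal
  have hl : Measurable fun q : E p × Theta p => ENNReal.ofReal (likelihood X γ y q.1) :=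
    ((continuous_likelihood X γ y).measurable.comp measurable_fst).ennreal_ofReal
  have hae : ∀ᵐ q ∂μ, q.2.2.1 ∈ Set.Icc k₁ k₂ ∧ q.2.1 = fun _ => L ^ q.2.2.1 :=
    Measure.quasiMeasurePreserving_snd.ae (ae_thetaPrior L hk)
  have hA' : MeasurableSet (Prod.fst ⁻¹' A : Set (E p × Theta p)) := measurable_fst hA
  rw [marginalPosterior, Measure.map_apply measurable_fst hA, jointPosterior, Measure.smul_apply,
    smul_eq_mul, withDensity_apply _ hA', jointPrior, ← hμ]
  refine mul_le_mul' (ENNReal.inv_le_inv.2 ?_) ?_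
  · rw [lintegral_withDensity_eq_lintegral_mul _ hd hl]
    set D : Set (Theta p) := {θ | θ.2.1 ∈ Set.Icc k₁ (k₁ + δ) ∧ θ.1 = fun _ => L ^ θ.2.1}
    have hBD : MeasurableSet (B ×ˢ D) := hB.prod (measurableSet_thetaIcc L _ _)
    rw [← thetaPrior_thetaIcc (p := p) L hk hδk, ← Measure.prod_prod, ← hμ,
      ← setLIntegral_const]
    refine (setLIntegral_mono' hBD fun q hq => ?_).trans (setLIntegral_le_lintegral _ _)
    have h := hG q.1 hq.1 q.2.2.1 hq.2.1
    rw [← hq.2.2] at h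
    exact h
  · rw [restrict_withDensity hA', lintegral_withDensity_eq_lintegral_mul _ hd hl]
    -- `F` does not depend on `θ`, whose prior has total mass one.
    have hFA : ∫⁻ β in A, F β = ∫⁻ q in Prod.fst ⁻¹' A, F q.1 ∂μ := by
      have hpre : (Prod.fst ⁻¹' A : Set (E p × Theta p)) = A ×ˢ Set.univ := by ext; simp
      rw [hpre, hμ, ← Measure.prod_restrict, Measure.restrict_univ,
        lintegral_prod _ (by fun_prop)]
      simp
    rw [hFA]
    refine lintegral_mono_ae ?_
    filter_upwards [ae_restrict_mem hA', ae_restrict_of_ae hae] with q hq hq'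
    have h := hF q.1 hq q.2.2.1 hq'.1
    rw [← hq'.2] at h
    exact h

/-! ### Power penalties: comparison of exponents and sparsity. -/

theorem rpow_le_rpow_add_one {x k α : ℝ} (hx : 0 ≤ x) (hk : 0 < k) (hkα : k ≤ α) :
    x ^ k ≤ x ^ α + 1 := by
  rcases le_total x 1 with h | h
  · have := Real.rpow_le_one hx h hk.le
    have := Real.rpow_nonneg hx α
    linarith
  · have := Real.rpow_le_rpow_of_exponent_le h hkα
    linarith

/-- For `x ≥ 1`, `x ^ α = x ^ k * exp u` with `u = (α - k) log x`. Here `x ^ k` and `log x` are at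
most `B`, so `δ` of order `B⁻²` makes the excess `2 u x ^ k` at most `1`. -/
theorem rpow_le_rpow_add_one_of_near {x B k α δ : ℝ} (hx : 0 ≤ x) (hxB : x ≤ B) (hB : 1 ≤ B)
    (hk : 0 < k) (hk1 : k ≤ 1) (hα : α ∈ Set.Icc k (k + δ)) (hδ : δ ≤ 1 / (2 * B ^ 2)) :
    x ^ α ≤ x ^ k + 1 := by
  rcases le_total x 1 with h | h
  · have := Real.rpow_le_one hx h (hk.le.trans hα.1)
    have := Real.rpow_nonneg hx k
    linarith
  · have hx0 : 0 < x := by linarith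
    have hB0 : 0 < B := by linarith
    set u := (α - k) * Real.log x
    have hlog0 : 0 ≤ Real.log x := Real.log_nonneg h
    have hlog : Real.log x ≤ B := by
      have := Real.log_le_sub_one_of_pos hx0
      linarith
    have hu0 : 0 ≤ u := mul_nonneg (by linarith [hα.1]) hlog0
    have hu : u ≤ 1 / (2 * B) := by
      calc u ≤ (1 / (2 * B ^ 2)) * B := by
            refine mul_le_mul (by linarith [hα.2]) hlog hlog0 (by positivity)
        _ = 1 / (2 * B) := by field_simp
    have hu1 : u ≤ 1 := hu.trans (by rw [div_le_one (by positivity)]; linarith)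
    have hexp : Real.exp u ≤ 1 + 2 * u := by
      have h1 := Real.abs_exp_sub_one_le (x := u) (by rw [abs_of_nonneg hu0]; exact hu1)
      rw [abs_of_nonneg hu0] at h1
      linarith [le_abs_self (Real.exp u - 1)]
    have hsplit : x ^ α = x ^ k * Real.exp u := by
      rw [Real.rpow_def_of_pos hx0, Real.rpow_def_of_pos hx0, ← Real.exp_add]
      congr 1
      simp only [u]
      ring
    have hxk : x ^ k ≤ B := by
      calc x ^ k ≤ x ^ (1 : ℝ) := Real.rpow_le_rpow_of_exponent_le h hk1
        _ = x := Real.rpow_one x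
        _ ≤ B := hxB
    have hxk0 : 0 ≤ x ^ k := Real.rpow_nonneg hx k
    have h2 : x ^ k * (2 * u) ≤ B * (2 * (1 / (2 * B))) := by gcongr
    have h3 : B * (2 * (1 / (2 * B))) = 1 := by field_simp
    rw [hsplit]
    nlinarith

/-- The power penalty `∑ (L |β_j|) ^ k`. -/
noncomputable def powPenalty {p : ℕ} (L k : ℝ) (β : E p) : ℝ := ∑ i, (L * |β i|) ^ k

theorem rpow_mul_abs_add_le {L k a b : ℝ} (hL : 0 ≤ L) (hk : 0 < k) (hk1 : k ≤ 1) :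
    (L * |a + b|) ^ k ≤ (L * |a|) ^ k + (L * |b|) ^ k := by
  calc (L * |a + b|) ^ k ≤ (L * |a| + L * |b|) ^ k := by
        refine Real.rpow_le_rpow (by positivity) ?_ hk.le
        rw [← mul_add]
        exact mul_le_mul_of_nonneg_left (abs_add_le a b) hL
    _ ≤ _ := Real.rpow_add_le_add_rpow (by positivity) (by positivity) hk.le hk1

theorem powPenalty_add_le {p : ℕ} {L k : ℝ} (hL : 0 ≤ L) (hk : 0 < k) (hk1 : k ≤ 1)
    (β h : E p) : powPenalty L k (β + h) ≤ powPenalty L k β + powPenalty L k h := by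
  simp only [powPenalty, ← Finset.sum_add_distrib]
  exact Finset.sum_le_sum fun i _ => rpow_mul_abs_add_le hL hk hk1

theorem sum_support_abs_le {p : ℕ} (β h : E p) :
    ∑ i with β i ≠ 0, |h i| ≤ √(numNonzero β) * ‖h‖ := by
  have hcard : ((Finset.univ.filter fun i => β i ≠ 0).card : ℝ) = numNonzero β := by
    rw [numNonzero, Nat.card_eq_fintype_card, Fintype.card_subtype]
  refine le_of_sq_le_sq ?_ (by positivity)
  calc (∑ i with β i ≠ 0, |h i|) ^ 2
      ≤ (Finset.univ.filter fun i => β i ≠ 0).card * ∑ i with β i ≠ 0, |h i| ^ 2 :=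
        sq_sum_le_card_mul_sum_sq
    _ ≤ numNonzero β * ∑ i, |h i| ^ 2 := by
        rw [hcard]
        gcongr
        exact Finset.subset_univ _
    _ = _ := by
        rw [mul_pow, Real.sq_sqrt (by positivity), EuclideanSpace.real_norm_sq_eq]
        simp

/-- Off the support of `β` the penalty is exactly additive. On the support, subadditivity applied to
`β = (β + h) - h` loses at most `2 (L |h i|) ^ k ≤ 2 (1 + L |h i|)`, and Cauchy–Schwarz sums this
over the support. -/
theorem le_powPenalty_add {p : ℕ} {L k : ℝ} (hL : 0 ≤ L) (hk : 0 < k) (hk1 : k ≤ 1)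
    (β h : E p) :
    powPenalty L k β + powPenalty L k h -
      2 * (numNonzero β + L * √(numNonzero β) * ‖h‖) ≤ powPenalty L k (β + h) := by
  have hcard : ((Finset.univ.filter fun i => β i ≠ 0).card : ℝ) = numNonzero β := by
    rw [numNonzero, Nat.card_eq_fintype_card, Fintype.card_subtype]
  have hterm : ∀ i, (L * |β i|) ^ k + (L * |h i|) ^ k -
      (if β i ≠ 0 then 2 * (1 + L * |h i|) else 0) ≤ (L * |(β + h) i|) ^ k := fun i => by
    by_cases hi : β i = 0
    · simp [hi, Real.zero_rpow hk.ne']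
    · rw [if_pos hi]
      have h1 := rpow_mul_abs_add_le (a := (β + h) i) (b := -h i) hL hk hk1
      rw [PiLp.add_apply, add_neg_cancel_right, abs_neg, ← PiLp.add_apply] at h1
      have h2 := rpow_le_rpow_add_one (x := L * |h i|) (by positivity) hk hk1
      rw [Real.rpow_one] at h2
      linarith
  have hsum := Finset.sum_le_sum fun i (_ : i ∈ Finset.univ) => hterm i
  rw [Finset.sum_sub_distrib, Finset.sum_add_distrib, ← Finset.sum_filter, ← Finset.mul_sum,
    Finset.sum_add_distrib, Finset.sum_const, nsmul_one, hcard, ← Finset.mul_sum] at hsum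
  have h3 := mul_le_mul_of_nonneg_left (sum_support_abs_le β h) hL
  simp only [powPenalty]
  linarith

theorem powPenalty_le_add_card {p : ℕ} {L k α : ℝ} (hL : 0 ≤ L) (hk : 0 < k) (hkα : k ≤ α)
    (β : E p) : powPenalty L k β ≤ powPenalty L α β + p := by
  have h : ∑ _i : Fin p, (1 : ℝ) = p := by simp
  rw [powPenalty, powPenalty, ← h, ← Finset.sum_add_distrib]
  exact Finset.sum_le_sum fun i _ => rpow_le_rpow_add_one (by positivity) hk hkα

theorem powPenalty_le_add_card_of_near {p : ℕ} {L k α B δ : ℝ} (hL : 0 ≤ L) (hk : 0 < k)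
    (hk1 : k ≤ 1) (hB : 1 ≤ B) (hα : α ∈ Set.Icc k (k + δ)) (hδ : δ ≤ 1 / (2 * B ^ 2))
    {β : E p} (hβ : ∀ i, L * |β i| ≤ B) : powPenalty L α β ≤ powPenalty L k β + p := by
  have h : ∑ _i : Fin p, (1 : ℝ) = p := by simp
  rw [powPenalty, powPenalty, ← h, ← Finset.sum_add_distrib]
  exact Finset.sum_le_sum fun i _ =>
    rpow_le_rpow_add_one_of_near (by positivity) (hβ i) hB hk hk1 hα hδ

/-! ### Normalizing constants and integrals of the prior kernel. -/

/-- The normalizing constant of the one-dimensional exponential power density. -/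
noncomputable def priorConst (γ α : ℝ) : ℝ :=
  α * γ ^ (1 / α) / (2 ^ (1 / α + 1) * Real.Gamma (1 / α))

theorem coefPriorDensity_eq {p : ℕ} {γ L α : ℝ} (hL : 0 < L) (hα : 0 < α) (β : E p) :
    coefPriorDensity γ (fun _ => L ^ α) α β =
      priorConst γ α ^ p * L ^ p * Real.exp (-(γ / 2) * powPenalty L α β) := by
  have h1 : (∏ _i : Fin p, L ^ α) ^ (1 / α) = L ^ p := by
    rw [Finset.prod_const, Finset.card_univ, Fintype.card_fin, ← Real.rpow_natCast,
      ← Real.rpow_natCast, ← Real.rpow_mul hL.le, ← Real.rpow_mul hL.le]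
    congr 1
    field_simp
  have h2 : ∑ i, L ^ α * |β i| ^ α = powPenalty L α β :=
    Finset.sum_congr rfl fun i _ => (Real.mul_rpow hL.le (abs_nonneg _)).symm
  rw [coefPriorDensity, h1, h2, priorConst]

/-- Continuity and positivity on a compact interval. The bounds are uniform in `α`, so the `p`-th
power of the constant costs only a factor geometric in `p`. -/
theorem exists_priorConst_bounds {γ k₁ k₂ : ℝ} (hγ : 0 < γ) (hk₁ : 0 < k₁) :
    ∃ c C : ℝ, 0 < c ∧ 0 < C ∧ ∀ α ∈ Set.Icc k₁ k₂, c ≤ priorConst γ α ∧ priorConst γ α ≤ C := by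
  rcases lt_or_ge k₂ k₁ with hlt | hle
  · exact ⟨1, 1, one_pos, one_pos, fun α hα => absurd (hα.1.trans hα.2) (not_le.2 hlt)⟩
  have hpos : ∀ α ∈ Set.Icc k₁ k₂, 0 < priorConst γ α := fun α hα => by
    have hα0 : 0 < α := hk₁.trans_le hα.1
    have := Real.Gamma_pos_of_pos (one_div_pos.2 hα0)
    unfold priorConst
    positivity
  have hcont : ContinuousOn (priorConst γ) (Set.Icc k₁ k₂) := fun α hα => by
    have hα0 : 0 < α := hk₁.trans_le hα.1
    have hΓ := Real.Gamma_pos_of_pos (one_div_pos.2 hα0)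
    have hinv : ContinuousAt (fun a : ℝ => 1 / a) α :=
      continuousAt_const.div continuousAt_id hα0.ne'
    have hΓc : ContinuousAt (fun a : ℝ => Real.Gamma (1 / a)) α := by
      refine ContinuousAt.comp (f := fun a : ℝ => 1 / a)
        (Real.differentiableAt_Gamma fun m => ?_).continuousAt hinv
      have := one_div_pos.2 hα0
      have : (0 : ℝ) ≤ m := m.cast_nonneg
      intro h
      linarith
    refine ContinuousAt.continuousWithinAt ?_
    refine ContinuousAt.div ?_ ?_ (by positivity)
    · exact continuousAt_id.mul (continuousAt_const.rpow hinv (Or.inl hγ.ne'))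
    · exact (continuousAt_const.rpow (hinv.add continuousAt_const) (Or.inl two_ne_zero)).mul hΓc
  have hne : (Set.Icc k₁ k₂).Nonempty := Set.nonempty_Icc.2 hle
  obtain ⟨a, ha, hmin⟩ := isCompact_Icc.exists_isMinOn hne hcont
  obtain ⟨b, hb, hmax⟩ := isCompact_Icc.exists_isMaxOn hne hcont
  exact ⟨_, _, hpos a ha, hpos b hb, fun α hα => ⟨hmin hα, hmax hα⟩⟩

theorem integrable_exp_neg_mul_abs_rpow {b k : ℝ} (hb : 0 < b) (hk : 0 < k) :
    Integrable fun t : ℝ => Real.exp (-b * |t| ^ k) := by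
  have h := integrableOn_rpow_mul_exp_neg_mul_rpow (s := 0) (by norm_num) hk hb
  simp only [Real.rpow_zero, one_mul] at h
  have hIoi : IntegrableOn (fun t : ℝ => Real.exp (-b * |t| ^ k)) (Set.Ioi 0) :=
    h.congr_fun (fun t ht => by simp only [abs_of_pos (Set.mem_Ioi.1 ht)]) measurableSet_Ioi
  have hIic : IntegrableOn (fun t : ℝ => Real.exp (-b * |t| ^ k)) (Set.Iic 0) := by
    have m : MeasurableEmbedding fun x : ℝ => -x := (Homeomorph.neg ℝ).measurableEmbedding
    rw [← Measure.map_neg_eq_self (volume : Measure ℝ), m.integrableOn_map_iff]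
    simp_rw [Function.comp_def, abs_neg, Set.neg_preimage, Set.neg_Iic, neg_zero]
    exact Iff.mpr integrableOn_Ici_iff_integrableOn_Ioi hIoi
  rw [← integrableOn_univ, ← Set.Iic_union_Ioi (a := (0 : ℝ))]
  exact hIic.union hIoi

/-- The kernel is a product over coordinates. The resulting `T ^ (-p)` is what cancels the volume of
a box of half-side `1 / T`. -/
theorem lintegral_exp_neg_powPenalty {p : ℕ} {b k T : ℝ} (hb : 0 < b) (hk : 0 < k) (hT : 0 < T)
    (β : E p) :
    ∫⁻ x : E p, ENNReal.ofReal (Real.exp (-b * powPenalty T k (x - β))) =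
      ENNReal.ofReal (((∫ t : ℝ, Real.exp (-b * |t| ^ k)) / T) ^ p) := by
  rw [lintegral_sub_right_eq_self
    (fun x : E p => ENNReal.ofReal (Real.exp (-b * powPenalty T k x))) β]
  have hprod : ∀ x : E p, Real.exp (-b * powPenalty T k x) =
      ∏ i, (fun t : ℝ => Real.exp (-b * |T * t| ^ k)) (x i) := fun x => by
    rw [powPenalty, Finset.mul_sum, Real.exp_sum]
    simp [abs_mul, abs_of_pos hT]
  simp_rw [hprod]
  have hInt : Integrable fun t : ℝ => Real.exp (-b * |T * t| ^ k) :=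
    (integrable_exp_neg_mul_abs_rpow hb hk).comp_mul_left' hT.ne'
  have hI : ∫ t : ℝ, Real.exp (-b * |T * t| ^ k) =
      (∫ t : ℝ, Real.exp (-b * |t| ^ k)) / T := by
    rw [Measure.integral_comp_mul_left (fun t : ℝ => Real.exp (-b * |t| ^ k)),
      abs_of_pos (inv_pos.2 hT), smul_eq_mul, div_eq_inv_mul]
  have hInt' : Integrable fun x : Fin p → ℝ =>
      ∏ i, (fun t : ℝ => Real.exp (-b * |T * t| ^ k)) (x i) :=
    Integrable.fintype_prod fun _ => hInt
  have hmp := PiLp.volume_preserving_ofLp (Fin p)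
  rw [← hI, hmp.lintegral_comp_emb (MeasurableEquiv.toLp 2 (Fin p → ℝ)).symm.measurableEmbedding
    (fun x : Fin p → ℝ => ENNReal.ofReal (∏ i, (fun t : ℝ => Real.exp (-b * |T * t| ^ k)) (x i))),
    ← ofReal_integral_eq_lintegral_ofReal hInt'
      (ae_of_all _ fun x => Finset.prod_nonneg fun i _ => by positivity),
    integral_fintype_prod_volume_eq_prod (𝕜 := ℝ)
      (fun (_ : Fin p) (t : ℝ) => Real.exp (-b * |T * t| ^ k))]
  simp

theorem volume_box {p : ℕ} {r : ℝ} (β : E p) :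
    MeasurableSet {x : E p | ∀ i, |x i - β i| ≤ r} ∧
    volume {x : E p | ∀ i, |x i - β i| ≤ r} = ENNReal.ofReal (2 * r) ^ p := by
  have hmp := PiLp.volume_preserving_ofLp (Fin p)
  have hset : {x : E p | ∀ i, |x i - β i| ≤ r} =
      WithLp.ofLp ⁻¹' (Set.univ.pi fun i => Metric.closedBall (β i) r) := by
    ext x
    simp [Real.dist_eq]
  have hmeas : MeasurableSet (Set.univ.pi fun i => Metric.closedBall (β i) r) :=
    MeasurableSet.univ_pi fun i => measurableSet_closedBall
  rw [hset]
  refine ⟨hmp.measurable hmeas, ?_⟩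
  rw [hmp.measure_preimage hmeas.nullMeasurableSet, volume_pi_pi]
  simp

/-! ### Pointwise bounds of prior times likelihood. -/

theorem mean_add {n p : ℕ} (X : Matrix (Fin n) (Fin p) ℝ) (β h : E p) :
    mean X (β + h) = mean X β + mean X h :=
  map_add (Matrix.toEuclideanLin X) β h

theorem likelihood_add {n p : ℕ} (X : Matrix (Fin n) (Fin p) ℝ) (γ : ℝ) (y : E n) (β h : E p) :
    likelihood X γ y (β + h) = likelihood X γ y β *
      Real.exp (-(γ / 2) * (‖mean X h‖ ^ 2 - 2 * inner ℝ (score X β y) h)) := by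
  rw [likelihood, likelihood, mul_assoc, ← Real.exp_add, mean_add, inner_score, ← sub_sub,
    norm_sub_sq_real]
  congr 2
  ring

theorem powPenalty_nonneg {p : ℕ} {L : ℝ} (hL : 0 ≤ L) (k : ℝ) (β : E p) :
    0 ≤ powPenalty L k β :=
  Finset.sum_nonneg fun i _ => by positivity

/-- Provides integrable decay at scale `T` whichever of prior and likelihood is sharper: if `T = L`
the prior gives it; otherwise the `k`-penalty is at most the quadratic one plus `p`, which a quarter
of the likelihood curvature absorbs. -/
theorem mul_powPenalty_le {p : ℕ} {L T k a s : ℝ} (hL : 0 ≤ L) (hT : 0 ≤ T) (hk : 0 < k)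
    (hk1 : k ≤ 1) (ha : 0 ≤ a) (ha1 : a ≤ 1) (hs : 0 ≤ s) (hTs : T = L ∨ 4 * a * T ^ 2 ≤ s)
    (h : E p) :
    a * powPenalty T k h - p ≤ s / 4 * ‖h‖ ^ 2 + powPenalty L k h := by
  have hpen := powPenalty_nonneg hL k h
  have hp : (0 : ℝ) ≤ p := p.cast_nonneg
  rcases hTs with rfl | hTs
  · have : a * powPenalty T k h ≤ powPenalty T k h := mul_le_of_le_one_left hpen ha1
    have : 0 ≤ s / 4 * ‖h‖ ^ 2 := by positivity
    linarith
  · have h1 := powPenalty_le_add_card hT hk (hk1.trans one_le_two) h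
    have h2 : powPenalty T 2 h = T ^ 2 * ‖h‖ ^ 2 := by
      rw [powPenalty, EuclideanSpace.real_norm_sq_eq, Finset.mul_sum]
      refine Finset.sum_congr rfl fun i _ => ?_
      rw [Real.rpow_two, mul_pow, sq_abs]
    rw [h2] at h1
    have h3 := mul_le_mul_of_nonneg_left h1 ha
    have h4 := mul_le_mul_of_nonneg_right hTs (sq_nonneg ‖h‖)
    have h5 : a * p ≤ p := mul_le_of_le_one_left hp ha1
    nlinarith

theorem sq_norm_le_of_abs_le {p : ℕ} {r : ℝ} {h : E p} (hh : ∀ i, |h i| ≤ r) :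
    ‖h‖ ^ 2 ≤ p * r ^ 2 := by
  rw [EuclideanSpace.real_norm_sq_eq]
  calc ∑ i, h i ^ 2 ≤ ∑ _i : Fin p, r ^ 2 :=
        Finset.sum_le_sum fun i _ => by
          rw [← sq_abs]
          exact pow_le_pow_left₀ (abs_nonneg _) (hh i) 2
    _ = p * r ^ 2 := by simp

section Bounds

variable {n p : ℕ} {X : Matrix (Fin n) (Fin p) ℝ} {y : E n} {β₀ : E p}
  {γ k L T s τ ε a D B δ c C α : ℝ}

/-- Upper bound of the posterior integrand away from the true parameter. -/
theorem prior_mul_likelihood_le (hγ : 0 < γ) (hk : 0 < k) (hk1 : k ≤ 1) (ha : 0 ≤ a)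
    (ha1 : a ≤ 1) (hL : 0 < L) (hT : 0 ≤ T) (hs : 0 ≤ s) (hTs : T = L ∨ 4 * a * T ^ 2 ≤ s)
    (hX : ∀ h, s * ‖h‖ ^ 2 ≤ ‖mean X h‖ ^ 2) (hτ : ‖score X β₀ y‖ ≤ τ) (hε : 0 < ε)
    (hfar : ∀ r, ε < r → 2 * τ * r +
      2 * (numNonzero β₀ + L * √(numNonzero β₀) * r) ≤ s / 2 * r ^ 2)
    (hkα : k ≤ α) (hC : priorConst γ α ≤ C) (hC0 : 0 ≤ priorConst γ α)
    {β : E p} (hβ : ε < ‖β - β₀‖) :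
    coefPriorDensity γ (fun _ => L ^ α) α β * likelihood X γ y β ≤
      likelihood X γ y β₀ * L ^ p * Real.exp (-(γ / 2) * powPenalty L k β₀) * C ^ p *
        Real.exp (γ * p - γ / 8 * s * ε ^ 2) *
        Real.exp (-(γ / 2 * a) * powPenalty T k (β - β₀)) := by
  obtain ⟨h, rfl⟩ : ∃ h, β = β₀ + h := ⟨β - β₀, by abel⟩
  rw [add_sub_cancel_left] at hβ ⊢
  have hlik : 0 ≤ likelihood X γ y β₀ := by unfold likelihood; positivity
  rw [coefPriorDensity_eq hL (hk.trans_le hkα), likelihood_add]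
  have h1 := powPenalty_le_add_card hL.le hk hkα (β₀ + h)
  have h2 := le_powPenalty_add hL.le hk hk1 β₀ h
  have h3 := mul_powPenalty_le hL.le hT hk hk1 ha ha1 hs hTs h
  have h4 := hfar _ hβ
  have h5 := hX h
  have h6 : inner ℝ (score X β₀ y) h ≤ τ * ‖h‖ :=
    (real_inner_le_norm _ _).trans (mul_le_mul_of_nonneg_right hτ (norm_nonneg _))
  have h7 : s / 4 * ε ^ 2 ≤ s / 4 * ‖h‖ ^ 2 := by gcongr
  -- Budget of `s ‖h‖²`: one half absorbs the score and the support loss (`h4`), one quarter pays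
  -- for the penalty at scale `T` (`h3`), and the last quarter leaves `s ε² / 4`. Each of `h1` and
  -- `h3` costs one `p`.
  have hexp : powPenalty L k β₀ - 2 * p + s / 4 * ε ^ 2 + a * powPenalty T k h ≤
      powPenalty L α (β₀ + h) + (‖mean X h‖ ^ 2 - 2 * inner ℝ (score X β₀ y) h) := by
    nlinarith
  calc priorConst γ α ^ p * L ^ p * Real.exp (-(γ / 2) * powPenalty L α (β₀ + h)) *
        (likelihood X γ y β₀ *
          Real.exp (-(γ / 2) * (‖mean X h‖ ^ 2 - 2 * inner ℝ (score X β₀ y) h)))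
      = likelihood X γ y β₀ * L ^ p * priorConst γ α ^ p *
        Real.exp (-(γ / 2) * (powPenalty L α (β₀ + h) +
          (‖mean X h‖ ^ 2 - 2 * inner ℝ (score X β₀ y) h))) := by
        rw [mul_add, Real.exp_add]
        ring
    _ ≤ likelihood X γ y β₀ * L ^ p * C ^ p *
        Real.exp (-(γ / 2) * powPenalty L k β₀ + (γ * p - γ / 8 * s * ε ^ 2) +
          -(γ / 2 * a) * powPenalty T k h) := by
        have hC' : 0 ≤ C := hC0.trans hC
        refine mul_le_mul ?_ ?_ (Real.exp_pos _).le (by positivity)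
        · gcongr
        · apply Real.exp_le_exp.2
          nlinarith
    _ = _ := by
        rw [Real.exp_add, Real.exp_add]
        ring

/-- Lower bound of the posterior integrand near the true parameter. -/
theorem le_prior_mul_likelihood (hγ : 0 < γ) (hk : 0 < k) (hk1 : k ≤ 1) (hL : 0 < L)
    (hT : 0 < T) (hLT : L ≤ T) (hD : 0 ≤ D)
    (hX : ∀ h, ‖mean X h‖ ^ 2 ≤ D * T ^ 2 * ‖h‖ ^ 2) (hp : (p : ℝ) ≤ T ^ 2)
    (hτ : ‖score X β₀ y‖ ≤ τ) (hB : 1 ≤ B) (hβB : ∀ i, L * (|β₀ i| + 1 / T) ≤ B)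
    (hδ : δ ≤ 1 / (2 * B ^ 2)) (hα : α ∈ Set.Icc k (k + δ)) (hc0 : 0 ≤ c)
    (hc : c ≤ priorConst γ α) {β : E p} (hβ : ∀ i, |β i - β₀ i| ≤ 1 / T) :
    likelihood X γ y β₀ * L ^ p * Real.exp (-(γ / 2) * powPenalty L k β₀) * c ^ p *
      Real.exp (-(γ / 2) * (2 * p + D * p + 2 * τ)) ≤
      coefPriorDensity γ (fun _ => L ^ α) α β * likelihood X γ y β := by
  obtain ⟨h, rfl⟩ : ∃ h, β = β₀ + h := ⟨β - β₀, by abel⟩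
  simp only [PiLp.add_apply, add_sub_cancel_left] at hβ
  have hlik : 0 ≤ likelihood X γ y β₀ := by unfold likelihood; positivity
  have hτ0 : 0 ≤ τ := (norm_nonneg _).trans hτ
  rw [coefPriorDensity_eq hL (hk.trans_le hα.1), likelihood_add]
  have hnorm := sq_norm_le_of_abs_le hβ
  have hTnorm : T ^ 2 * ‖h‖ ^ 2 ≤ p := by
    calc T ^ 2 * ‖h‖ ^ 2 ≤ T ^ 2 * ((p : ℝ) * (1 / T) ^ 2) := by gcongr
      _ = (p : ℝ) := by field_simp
  -- From `T² ‖h‖² ≤ p ≤ T²`; the score then contributes at most `2 τ`.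
  have hnorm1 : ‖h‖ ≤ 1 := by
    refine le_of_sq_le_sq ?_ zero_le_one
    have hT2 : 0 < T ^ 2 := by positivity
    by_contra! hcon
    nlinarith
  have h1 : powPenalty L α (β₀ + h) ≤ powPenalty L k (β₀ + h) + p := by
    refine powPenalty_le_add_card_of_near hL.le hk hk1 hB hα hδ fun i => ?_
    refine le_trans (mul_le_mul_of_nonneg_left ?_ hL.le) (hβB i)
    exact (abs_add_le (β₀ i) (h i)).trans (by linarith [hβ i])
  have h2 := powPenalty_add_le hL.le hk hk1 β₀ h
  have h3 : powPenalty L k h ≤ p := by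
    calc powPenalty L k h ≤ ∑ _i : Fin p, (1 : ℝ) := by
          refine Finset.sum_le_sum fun i _ => Real.rpow_le_one (by positivity) ?_ hk.le
          calc L * |h i| ≤ T * (1 / T) := by gcongr; exact hβ i
            _ = 1 := by field_simp
      _ = p := by simp
  have h4 : ‖mean X h‖ ^ 2 ≤ D * p := by
    calc ‖mean X h‖ ^ 2 ≤ D * (T ^ 2 * ‖h‖ ^ 2) := by rw [← mul_assoc]; exact hX h
      _ ≤ D * p := by gcongr
  have h5 : -τ ≤ inner ℝ (score X β₀ y) h := by
    have h6 := (abs_real_inner_le_norm (score X β₀ y) h).trans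
      (mul_le_mul hτ hnorm1 (norm_nonneg _) hτ0)
    rw [mul_one] at h6
    exact (abs_le.1 h6).1
  calc likelihood X γ y β₀ * L ^ p * Real.exp (-(γ / 2) * powPenalty L k β₀) * c ^ p *
        Real.exp (-(γ / 2) * (2 * p + D * p + 2 * τ))
      = likelihood X γ y β₀ * L ^ p * c ^ p *
        Real.exp (-(γ / 2) * (powPenalty L k β₀ + (2 * p + D * p + 2 * τ))) := by
        rw [mul_add (-(γ / 2)) (powPenalty L k β₀), Real.exp_add]
        ring
    _ ≤ likelihood X γ y β₀ * L ^ p * priorConst γ α ^ p *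
        Real.exp (-(γ / 2) * (powPenalty L α (β₀ + h) +
          (‖mean X h‖ ^ 2 - 2 * inner ℝ (score X β₀ y) h))) := by
        have hc' : 0 ≤ priorConst γ α := hc0.trans hc
        refine mul_le_mul ?_ ?_ (Real.exp_pos _).le (by positivity)
        · gcongr
        · apply Real.exp_le_exp.2
          nlinarith
    _ = _ := by
        rw [mul_add (-(γ / 2)), Real.exp_add]
        ring

end Bounds

/-! ### The non-asymptotic posterior bound. -/

/-- Non-asymptotic bound of the marginal posterior probability outside a ball around `β₀`. -/
theorem exists_marginalPosterior_bound {γ k₁ k₂ a D : ℝ} (hγ : 0 < γ) (hk₁ : 0 < k₁)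
    (hk₁' : k₁ ≤ 1) (hk : k₁ < k₂) (ha : 0 < a) (ha1 : a ≤ 1) (hD : 0 ≤ D) :
    ∃ R : ℝ, 0 < R ∧ ∀ {n p : ℕ} {X : Matrix (Fin n) (Fin p) ℝ} {y : E n} {β₀ : E p}
      {L T s τ ε B δ : ℝ}, 0 < L → 0 < T → L ≤ T → 0 ≤ s → (T = L ∨ 4 * a * T ^ 2 ≤ s) →
      (∀ h, s * ‖h‖ ^ 2 ≤ ‖mean X h‖ ^ 2) → (∀ h, ‖mean X h‖ ^ 2 ≤ D * T ^ 2 * ‖h‖ ^ 2) →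
      (p : ℝ) ≤ T ^ 2 → ‖score X β₀ y‖ ≤ τ → 0 < ε →
      (∀ r, ε < r → 2 * τ * r +
        2 * (numNonzero β₀ + L * √(numNonzero β₀) * r) ≤ s / 2 * r ^ 2) →
      1 ≤ B → (∀ i, L * (|β₀ i| + 1 / T) ≤ B) → 0 < δ → δ ≤ 1 / (2 * B ^ 2) → k₁ + δ ≤ k₂ →
      marginalPosterior X γ k₁ k₂ L y {β | ε < ‖β - β₀‖} ≤
        ENNReal.ofReal (R ^ p * Real.exp (γ * τ - γ / 8 * s * ε ^ 2) * ((k₂ - k₁) / δ)) := by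
  obtain ⟨c, C, hc, hC, hcC⟩ := exists_priorConst_bounds (k₂ := k₂) hγ hk₁
  have hb : 0 < γ / 2 * a := by positivity
  set I := ∫ t : ℝ, Real.exp (-(γ / 2 * a) * |t| ^ k₁) with hI
  have hI0 : 0 < I := integral_exp_pos (integrable_exp_neg_mul_abs_rpow hb hk₁)
  -- Per coordinate: the ratio of normalizing constants, the ratio of kernel integral to box side
  -- (free of `T`), and the exponential costs `2` from above and `2 + D` from below.
  refine ⟨C / c * (I / 2) * Real.exp (γ / 2 * (4 + D)), by positivity, ?_⟩
  intro n p X y β₀ L T s τ ε B δ hL hT hLT hs hTs hXl hXu hp hτ hε hfar hB hβB hδ0 hδ hδk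
  -- The factor common to both bounds, which cancels in the ratio.
  set W := likelihood X γ y β₀ * L ^ p * Real.exp (-(γ / 2) * powPenalty L k₁ β₀) with hW
  have hW0 : 0 < W := by
    have : 0 < likelihood X γ y β₀ := by unfold likelihood; positivity
    positivity
  have hcC0 : ∀ α ∈ Set.Icc k₁ k₂, 0 ≤ priorConst γ α := fun α hα => hc.le.trans (hcC α hα).1
  have hdens0 : ∀ α ∈ Set.Icc k₁ k₂, ∀ β : E p, 0 ≤ coefPriorDensity γ (fun _ => L ^ α) α β :=
    fun α hα β => by
      have := hcC0 α hα
      rw [coefPriorDensity_eq hL (hk₁.trans_le hα.1)]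
      positivity
  obtain ⟨hBm, hBv⟩ := volume_box (r := 1 / T) β₀
  have hfm : Measurable fun β : E p =>
      ENNReal.ofReal (Real.exp (-(γ / 2 * a) * powPenalty T k₁ (β - β₀))) := by
    unfold powPenalty
    fun_prop
  have hA : MeasurableSet {β : E p | ε < ‖β - β₀‖} :=
    measurableSet_lt measurable_const (by fun_prop)
  refine (marginalPosterior_le X y hk hδk hA hBm
    (F := fun β => ENNReal.ofReal (W * C ^ p * Real.exp (γ * p - γ / 8 * s * ε ^ 2)) *
      ENNReal.ofReal (Real.exp (-(γ / 2 * a) * powPenalty T k₁ (β - β₀))))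
    (G := ENNReal.ofReal (W * c ^ p * Real.exp (-(γ / 2) * (2 * p + D * p + 2 * τ))))
    ?_ (hfm.const_mul _) ?_).trans ?_
  · intro β hβ α hα
    rw [← ENNReal.ofReal_mul (hdens0 α hα β), ← ENNReal.ofReal_mul (by positivity)]
    exact ENNReal.ofReal_le_ofReal (prior_mul_likelihood_le hγ hk₁ hk₁' ha.le ha1 hL hT.le hs hTs
      hXl hτ hε hfar hα.1 (hcC α hα).2 (hcC0 α hα) hβ)
  · intro β hβ α hα
    have hα' : α ∈ Set.Icc k₁ k₂ := ⟨hα.1, hα.2.trans hδk⟩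
    rw [← ENNReal.ofReal_mul (hdens0 α hα' β)]
    exact ENNReal.ofReal_le_ofReal (le_prior_mul_likelihood hγ hk₁ hk₁' hL hT hLT hD hXu hp hτ hB
      hβB hδ hα hc.le (hcC α hα').1 hβ)
  · have hInt : ∫⁻ β in {β : E p | ε < ‖β - β₀‖},
        ENNReal.ofReal (W * C ^ p * Real.exp (γ * p - γ / 8 * s * ε ^ 2)) *
          ENNReal.ofReal (Real.exp (-(γ / 2 * a) * powPenalty T k₁ (β - β₀))) ≤
        ENNReal.ofReal (W * C ^ p * Real.exp (γ * p - γ / 8 * s * ε ^ 2) * (I / T) ^ p) := by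
      refine (setLIntegral_le_lintegral _ _).trans ?_
      rw [lintegral_const_mul _ hfm, lintegral_exp_neg_powPenalty hb hk₁ hT, ← hI,
        ← ENNReal.ofReal_mul (by positivity)]
    refine (mul_le_mul_right hInt _).trans ?_
    have hk0 : 0 < k₂ - k₁ := by linarith
    rw [hBv, ← ENNReal.ofReal_pow (by positivity), ← ENNReal.ofReal_mul (by positivity),
      ← ENNReal.ofReal_mul (by positivity), ← ENNReal.ofReal_inv_of_pos (by positivity),
      ← ENNReal.ofReal_mul (by positivity)]
    refine le_of_eq (congrArg ENNReal.ofReal ?_)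
    have hE : Real.exp (γ * p - γ / 8 * s * ε ^ 2) =
        Real.exp (γ / 2 * (4 + D)) ^ p * Real.exp (γ * τ - γ / 8 * s * ε ^ 2) *
          Real.exp (-(γ / 2) * (2 * p + D * p + 2 * τ)) := by
      rw [← Real.exp_nat_mul, ← Real.exp_add, ← Real.exp_add]
      congr 1
      ring
    rw [hE]
    have := Real.exp_pos (-(γ / 2) * (2 * p + D * p + 2 * τ))
    simp only [mul_pow, div_pow, one_pow]
    field_simp

/-! ### Almost sure control of the score. -/

/-- If `Xₙ` has largest singular value of order `√n` and `pₙ = o(n)`, the score at the true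
parameter is almost surely of order `o(n)`. -/
theorem ae_eventually_norm_score_le {Ω : Type*} [MeasurableSpace Ω] {P : Measure Ω}
    {γ : ℝ} (hγ : 0 < γ) {p : ℕ → ℕ} {X : (n : ℕ) → Matrix (Fin n) (Fin (p n)) ℝ}
    {β₀ : (n : ℕ) → E (p n)} {y : (n : ℕ) → Ω → E n}
    (hy : ∀ n, HasLaw (y n) (dataLaw (X n) γ (β₀ n)) P)
    (hp : (fun n => (p n : ℝ)) =o[atTop] (fun n : ℕ => (n : ℝ))) {S : ℝ} (hS : 0 < S)
    (hX : ∀ᶠ n : ℕ in atTop, ∀ h, ‖mean (X n) h‖ ≤ S * √(n : ℝ) * ‖h‖) {η : ℝ} (hη : 0 < η) :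
    ∀ᵐ ω ∂P, ∀ᶠ n : ℕ in atTop, ‖score (X n) (β₀ n) (y n ω)‖ ≤ η * n := by
  -- The concentration exponent equals `2 c n`; one `c n` absorbs `2 ^ (p/2)`, the other gives a
  -- geometric series.
  set c : ℝ := γ * η ^ 2 / (8 * S ^ 2) with hc
  have hc0 : 0 < c := by positivity
  obtain ⟨N, hN⟩ := eventually_atTop.1
    ((hX.and (hp.def hc0)).and (eventually_ge_atTop 1))
  have hbound : ∀ n, P {ω | N ≤ n ∧ η * n < ‖score (X n) (β₀ n) (y n ω)‖} ≤
      ENNReal.ofReal (Real.exp (-c) ^ n) := fun n => by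
    by_cases hn : N ≤ n
    · obtain ⟨⟨hXn, hpn⟩, hn1⟩ := hN n hn
      simp only [hn, true_and]
      have hn0 : (0 : ℝ) < n := by exact_mod_cast hn1
      have hmeas : MeasurableSet {z | η * n < ‖score (X n) (β₀ n) z‖} :=
        measurableSet_lt measurable_const (continuous_score (X n) (β₀ n)).norm.measurable
      have hmap : P {ω | η * n < ‖score (X n) (β₀ n) (y n ω)‖} =
          dataLaw (X n) γ (β₀ n) {z | η * n < ‖score (X n) (β₀ n) z‖} := by
        rw [← (hy n).map_eq, Measure.map_apply_of_aemeasurable (hy n).aemeasurable hmeas]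
        rfl
      rw [hmap]
      refine (dataLaw_norm_score_gt_le (X n) hγ (by positivity) hXn (β₀ n)
        (by positivity)).trans (ENNReal.ofReal_le_ofReal ?_)
      have h2 : (2 : ℝ) ^ ((p n : ℝ) / 2) ≤ Real.exp (c * n) := by
        rw [Real.rpow_def_of_pos two_pos]
        apply Real.exp_le_exp.2
        simp only [Real.norm_natCast] at hpn
        have := Real.log_two_lt_d9
        have := (p n).cast_nonneg (α := ℝ)
        nlinarith
      rw [← Real.exp_nat_mul]
      calc (2 : ℝ) ^ ((p n : ℝ) / 2) *
            Real.exp (-(γ / (4 * (S * √(n : ℝ)) ^ 2) * (η * n) ^ 2))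
          ≤ Real.exp (c * n) * Real.exp (-(γ / (4 * (S * √(n : ℝ)) ^ 2) * (η * n) ^ 2)) := by
            gcongr
        _ = Real.exp (n * -c) := by
            rw [← Real.exp_add, mul_pow, Real.sq_sqrt hn0.le, hc]
            congr 1
            field_simp
            ring
    · simp [hn]
  -- The first Borel–Cantelli lemma needs no independence, so the joint law of the `y n` is
  -- irrelevant.
  have hsum : ∑' n, P {ω | N ≤ n ∧ η * n < ‖score (X n) (β₀ n) (y n ω)‖} ≠ ∞ := by
    refine ne_top_of_le_ne_top ?_ (ENNReal.tsum_le_tsum hbound)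
    refine (summable_geometric_of_lt_one (Real.exp_pos _).le ?_).tsum_ofReal_ne_top
    simpa using hc0
  filter_upwards [ae_eventually_notMem hsum] with ω hω
  filter_upwards [hω, eventually_ge_atTop N] with n hn hNn
  by_contra! hcon
  exact hn ⟨hNn, hcon⟩

/-! ### Consequences of the growth conditions. -/

theorem numNonzero_le {p : ℕ} (β : E p) : numNonzero β ≤ p := by
  rw [numNonzero, Nat.card_eq_fintype_card]
  exact (Fintype.card_subtype_le _).trans_eq (Fintype.card_fin p)

theorem sigmaMin_eq_zero_of_isEmpty {n : ℕ} (X : Matrix (Fin n) (Fin 0) ℝ) : sigmaMin X = 0 :=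
  LinearMap.singularValues_of_finrank_le _ (by simp)

/-- For `p = 0` the index `min n p - 1` truncates to `0`, where the singular value is `0` by
default. The lower spectral bound thus excludes `p = 0`, for which `L` would vanish. -/
theorem pos_of_sigmaMin_pos {n p : ℕ} {X : Matrix (Fin n) (Fin p) ℝ} (h : 0 < sigmaMin X) :
    0 < p := by
  rcases Nat.eq_zero_or_pos p with rfl | hp
  · exact absurd (sigmaMin_eq_zero_of_isEmpty X) h.ne'
  · exact hp

/-- The growth conditions make `L √m` of order `o(n)`, where `L` is the scale of the prior. -/
theorem scale_mul_sqrt_le {n p C ρ m η : ℝ} (hn : 1 < n) (hp : 0 < p)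
    (hm0 : 0 ≤ m) (hη : 0 < η) (hC : C ^ 2 ≤ η * n)
    (hm : m ≤ η * (n ^ (1 - ρ) / (p * Real.log n ^ 2))) :
    C * √p * n ^ (ρ / 2) * Real.log n * √m ≤ η * n := by
  have hn0 : 0 < n := by linarith
  have hlog : 0 < Real.log n := Real.log_pos hn
  refine le_of_sq_le_sq ?_ (by positivity)
  have hρ : (n ^ (ρ / 2)) ^ 2 = n ^ ρ := by
    rw [← Real.rpow_natCast, ← Real.rpow_mul hn0.le]
    congr 1
    push_cast
    ring
  have hsplit : n ^ (1 - ρ) * n ^ ρ = n := by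
    rw [← Real.rpow_add hn0, sub_add_cancel, Real.rpow_one]
  have hm' : p * n ^ ρ * Real.log n ^ 2 * m ≤ η * n := by
    calc p * n ^ ρ * Real.log n ^ 2 * m
        ≤ p * n ^ ρ * Real.log n ^ 2 * (η * (n ^ (1 - ρ) / (p * Real.log n ^ 2))) := by gcongr
      _ = η * (n ^ (1 - ρ) * n ^ ρ) := by field_simp
      _ = η * n := by rw [hsplit]
  calc (C * √p * n ^ (ρ / 2) * Real.log n * √m) ^ 2
      = C ^ 2 * (p * n ^ ρ * Real.log n ^ 2 * m) := by
        simp only [mul_pow, hρ, Real.sq_sqrt hp.le, Real.sq_sqrt hm0]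
        ring
    _ ≤ (η * n) * (η * n) := by gcongr
    _ = (η * n) ^ 2 := by ring

/-- A crude polynomial bound suffices: it only serves to keep `1 / δ` polynomial in `n`. -/
theorem scale_le_pow {n p C ρ : ℝ} (hn : 1 < n) (hpn : p ≤ n)
    (hC : C ^ 2 ≤ n) (hρ : ρ ≤ 1) :
    C * √p * n ^ (ρ / 2) * Real.log n ≤ n ^ 3 := by
  have hn0 : 0 < n := by linarith
  have hlog : 0 < Real.log n := Real.log_pos hn
  have h1 : C ≤ √n := Real.le_sqrt_of_sq_le hC
  have h2 : √p ≤ √n := Real.sqrt_le_sqrt hpn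
  have h3 : n ^ (ρ / 2) ≤ n := by
    calc n ^ (ρ / 2) ≤ n ^ (1 : ℝ) := Real.rpow_le_rpow_of_exponent_le hn.le (by linarith)
      _ = n := Real.rpow_one n
  have h4 : Real.log n ≤ n := (Real.log_le_sub_one_of_pos hn0).trans (by linarith)
  calc C * √p * n ^ (ρ / 2) * Real.log n ≤ √n * √n * n * n := by gcongr
    _ = n ^ 3 := by rw [Real.mul_self_sqrt hn0.le]; ring

end BayesPenalized

/-! ### Assembly of the asymptotic statement. -/

open BayesPenalized in
set_option maxHeartbeats 1000000 in
theorem theorem3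
    {Ω : Type*} [MeasurableSpace Ω] (P : Measure Ω) [IsProbabilityMeasure P]
    (γ : ℝ) (hγ : 0 < γ)
    (k₁ k₂ : ℝ) (hk₁ : 0 < k₁) (hk₁' : k₁ ≤ 1) (hk₂ : 2 ≤ k₂)
    (ρ : ℝ) (hρ : ρ ∈ Set.Ioo (0 : ℝ) 1)
    (p : ℕ → ℕ)
    (X : (n : ℕ) → Matrix (Fin n) (Fin (p n)) ℝ)
    (β₀ : (n : ℕ) → BayesPenalized.E (p n))
    (C : ℕ → ℝ)
    (y : (n : ℕ) → Ω → BayesPenalized.E n)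
    (hy : ∀ n, HasLaw (y n) (BayesPenalized.dataLaw (X n) γ (β₀ n)) P)
    (hp : (fun n => (p n : ℝ)) =o[atTop] (fun n : ℕ => (n : ℝ)))
    (Λmin Λmax : ℝ) (hΛ : 0 < Λmin)
    (hmin : (Λmin : EReal) <
      liminf (fun n : ℕ => ((BayesPenalized.sigmaMin (X n) / √(n : ℝ) : ℝ) : EReal)) atTop)
    (hmax : limsup (fun n : ℕ => ((BayesPenalized.sigmaMax (X n) / √(n : ℝ) : ℝ) : EReal)) atTop
      < (Λmax : EReal))
    (hβ : ∃ M : ℝ, ∀ n, ∀ j, |β₀ n j| ≤ M)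
    (hm : (fun n => (BayesPenalized.numNonzero (β₀ n) : ℝ)) =o[atTop]
      (fun n : ℕ => (n : ℝ) ^ (1 - ρ) / ((p n : ℝ) * Real.log n ^ 2)))
    (hC : ∀ n, 0 < C n)
    (hC' : (fun n => C n ^ 2) =o[atTop] (fun n : ℕ => (n : ℝ))) :
    ∀ ε : ℝ, 0 < ε → ∀ᵐ ω ∂P,
      Tendsto
        (fun n : ℕ =>
          BayesPenalized.marginalPosterior (X n) γ k₁ k₂
            (C n * √(p n : ℝ) * (n : ℝ) ^ (ρ / 2) * Real.log n) (y n ω)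
            {β | ε < ‖β - β₀ n‖})
        atTop (𝓝 0) := by
  intro ε hε
  obtain ⟨M, hM⟩ := hβ
  have hlow : ∀ᶠ n : ℕ in atTop, Λmin < sigmaMin (X n) / √(n : ℝ) :=
    (eventually_lt_of_lt_liminf hmin).mono fun n hn => EReal.coe_lt_coe_iff.1 hn
  have hup : ∀ᶠ n : ℕ in atTop, sigmaMax (X n) / √(n : ℝ) < Λmax :=
    (eventually_lt_of_limsup_lt hmax).mono fun n hn => EReal.coe_lt_coe_iff.1 hn
  have hΛmax : 0 < Λmax := by
    obtain ⟨n, hn⟩ := hup.exists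
    have : 0 ≤ sigmaMax (X n) := LinearMap.singularValues_nonneg _ _
    exact lt_of_le_of_lt (by positivity) hn
  have hXup : ∀ᶠ n : ℕ in atTop, ∀ h, ‖mean (X n) h‖ ≤ Λmax * √(n : ℝ) * ‖h‖ := by
    filter_upwards [hup, eventually_ge_atTop 1] with n hn hn1 h
    have hn0 : (0 : ℝ) < n := by exact_mod_cast hn1
    rw [div_lt_iff₀ (by positivity)] at hn
    exact (norm_mean_le (X n) h).trans (by gcongr)
  set a : ℝ := min (Λmin ^ 2 / 4) 1 with ha
  have ha0 : 0 < a := lt_min (by positivity) one_pos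
  have hk : k₁ < k₂ := by linarith
  obtain ⟨R, hR0, hR⟩ := exists_marginalPosterior_bound (a := a) (D := Λmax ^ 2) hγ hk₁ hk₁' hk
    ha0 (min_le_right _ _) (by positivity)
  -- The first bound makes the linear and constant terms at most half the curvature for `r > ε`, the
  -- second keeps `γ τ` below half of `γ s ε² / 8`, the third gives `p ≤ n` and `C² ≤ n`.
  set η : ℝ := min (Λmin ^ 2 / (2 * (4 / ε + 2 / ε ^ 2))) (min (Λmin ^ 2 * ε ^ 2 / 16) 1) with hη
  have hη0 : 0 < η := lt_min (by positivity) (lt_min (by positivity) one_pos)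
  have hη1 : η * (4 / ε + 2 / ε ^ 2) ≤ Λmin ^ 2 / 2 := by
    have h : η ≤ Λmin ^ 2 / (2 * (4 / ε + 2 / ε ^ 2)) := min_le_left _ _
    rw [le_div_iff₀ (by positivity)] at h
    linarith
  have hη2 : η ≤ Λmin ^ 2 * ε ^ 2 / 16 := (min_le_right _ _).trans (min_le_left _ _)
  have hη3 : η ≤ 1 := (min_le_right _ _).trans (min_le_right _ _)
  -- After the score is paid the exponent is `-2 c n`; `R ^ p ≤ exp (c n)` uses half of it.
  set c : ℝ := γ * Λmin ^ 2 * ε ^ 2 / 32 with hc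
  have hc0 : 0 < c := by positivity
  filter_upwards [ae_eventually_norm_score_le hγ hy hp hΛmax hXup hη0] with ω hω
  have hlim : Tendsto (fun n : ℕ => ENNReal.ofReal
      ((k₂ - k₁) * 2 * ((n : ℝ) ^ 8 * Real.exp (-c * n)))) atTop (𝓝 0) := by
    have h1 : Tendsto (fun x : ℝ => x ^ (8 : ℝ) * Real.exp (-c * x)) atTop (𝓝 0) :=
      tendsto_rpow_mul_exp_neg_mul_atTop_nhds_zero 8 c hc0
    have h2 := ((h1.comp tendsto_natCast_atTop_atTop).const_mul ((k₂ - k₁) * 2))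
    rw [mul_zero] at h2
    have h3 := ENNReal.tendsto_ofReal h2
    rw [ENNReal.ofReal_zero] at h3
    refine h3.congr fun n => ?_
    simp only [Function.comp_apply]
    norm_cast
  refine tendsto_of_tendsto_of_tendsto_of_le_of_le' tendsto_const_nhds hlim
    (Eventually.of_forall fun n => zero_le) ?_
  have hp1 := hp.def hη0
  have hp2 := hp.def (div_pos hc0 (by positivity : 0 < |Real.log R| + 1))
  have hM1 : ∀ᶠ n : ℕ in atTop, M + 1 ≤ n := tendsto_natCast_atTop_atTop.eventually_ge_atTop _
  filter_upwards [hω, hlow, hXup, hp1, hp2, hm.def hη0, hC'.def hη0, hM1, eventually_gt_atTop 1]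
    with n hscore hlown hXn hpn hpn2 hmn hCn hMn hn1
  have hn1' : (1 : ℝ) < n := by exact_mod_cast hn1
  have hn0 : (0 : ℝ) < n := by linarith
  have hsqrt : 0 < √(n : ℝ) := Real.sqrt_pos.2 hn0
  have hsqrtsq : √(n : ℝ) ^ 2 = n := Real.sq_sqrt hn0.le
  simp only [Real.norm_natCast] at hpn hpn2 hmn hCn
  rw [Real.norm_of_nonneg (by positivity)] at hCn
  have hlog : 0 < Real.log n := Real.log_pos hn1'
  rw [Real.norm_of_nonneg (by positivity)] at hmn
  have hηn : η * n ≤ n := mul_le_of_le_one_left hn0.le hη3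
  have hpn' : (p n : ℝ) ≤ n := hpn.trans hηn
  rw [lt_div_iff₀ hsqrt] at hlown
  have hpnat : 0 < p n := pos_of_sigmaMin_pos (lt_of_le_of_lt (by positivity) hlown)
  have hp0 : (0 : ℝ) < p n := by exact_mod_cast hpnat
  set L : ℝ := C n * √(p n : ℝ) * (n : ℝ) ^ (ρ / 2) * Real.log n with hL
  have hL0 : 0 < L := by
    have := hC n
    positivity
  set T : ℝ := max L √(n : ℝ) with hT
  have hT0 : 0 < T := hL0.trans_le (le_max_left _ _)
  have hnT : (n : ℝ) ≤ T ^ 2 := by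
    rw [← hsqrtsq]
    exact pow_le_pow_left₀ hsqrt.le (le_max_right _ _) 2
  have hT1 : 1 ≤ T := (Real.one_le_sqrt.2 hn1'.le).trans (le_max_right _ _)
  have hLm : L * √(numNonzero (β₀ n) : ℝ) ≤ η * n :=
    scale_mul_sqrt_le hn1' hp0 (Nat.cast_nonneg _) hη0 hCn hmn
  have hmp : (numNonzero (β₀ n) : ℝ) ≤ η * n :=
    le_trans (by exact_mod_cast numNonzero_le (β₀ n)) hpn
  have hL3 : L ≤ (n : ℝ) ^ 3 :=
    scale_le_pow hn1' hpn' (hCn.trans hηn) hρ.2.le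
  have hB1 : 1 ≤ (n : ℝ) ^ 4 := one_le_pow₀ hn1'.le
  have hδ : 1 / (2 * ((n : ℝ) ^ 4) ^ 2) ≤ 1 := by
    rw [div_le_one (by positivity)]
    linarith [one_le_pow₀ hB1 (n := 2)]
  -- `B = n ^ 4` comes from `L ≤ n ^ 3` and `|β₀ i| + 1 / T ≤ M + 1 ≤ n`; the largest admissible `δ`
  -- then produces the factor `n ^ 8`.
  refine (hR (X := X n) (y := y n ω) (β₀ := β₀ n) (L := L) (T := T) (s := Λmin ^ 2 * n)
    (τ := η * n) (ε := ε) (B := (n : ℝ) ^ 4) (δ := 1 / (2 * ((n : ℝ) ^ 4) ^ 2))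
    hL0 hT0 (le_max_left _ _) (by positivity) ?_ ?_ ?_ (hpn'.trans hnT) hscore hε ?_ hB1 ?_
    (by positivity) le_rfl (by linarith)).trans (ENNReal.ofReal_le_ofReal ?_)
  · rcases max_choice L √(n : ℝ) with h | h
    · exact Or.inl h
    · right
      rw [hT, h, hsqrtsq]
      have : a ≤ Λmin ^ 2 / 4 := min_le_left _ _
      nlinarith
  · intro h
    have h1 := le_norm_mean (by exact_mod_cast hpn') (X n) h
    have h2 : Λmin * √(n : ℝ) * ‖h‖ ≤ ‖mean (X n) h‖ :=
      le_trans (by gcongr) h1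
    calc Λmin ^ 2 * n * ‖h‖ ^ 2 = (Λmin * √(n : ℝ) * ‖h‖) ^ 2 := by
          rw [mul_pow, mul_pow, hsqrtsq]
      _ ≤ _ := pow_le_pow_left₀ (by positivity) h2 2
  · intro h
    calc ‖mean (X n) h‖ ^ 2 ≤ (Λmax * √(n : ℝ) * ‖h‖) ^ 2 :=
          pow_le_pow_left₀ (norm_nonneg _) (hXn h) 2
      _ = Λmax ^ 2 * n * ‖h‖ ^ 2 := by rw [mul_pow, mul_pow, hsqrtsq]
      _ ≤ _ := by gcongr
  · intro r hr
    have hr0 : 0 < r := hε.trans hr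
    have h1 : r ≤ r ^ 2 / ε := by
      rw [le_div_iff₀ hε]
      nlinarith
    have h2 : 1 ≤ r ^ 2 / ε ^ 2 := by
      rw [one_le_div (by positivity)]
      exact pow_le_pow_left₀ hε.le hr.le 2
    calc 2 * (η * n) * r +
          2 * (numNonzero (β₀ n) + L * √(numNonzero (β₀ n) : ℝ) * r)
        ≤ 2 * (η * n) * r + 2 * (η * n + η * n * r) := by gcongr
      _ = η * n * (4 * r + 2 * 1) := by ring
      _ ≤ η * n * (4 * (r ^ 2 / ε) + 2 * (r ^ 2 / ε ^ 2)) := by gcongr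
      _ = η * (4 / ε + 2 / ε ^ 2) * (n * r ^ 2) := by ring
      _ ≤ Λmin ^ 2 / 2 * (n * r ^ 2) := by gcongr
      _ = Λmin ^ 2 * n / 2 * r ^ 2 := by ring
  · intro i
    have h1 : |β₀ n i| + 1 / T ≤ n := by
      have : 1 / T ≤ 1 := (div_le_one hT0).2 hT1
      linarith [hM n i]
    calc L * (|β₀ n i| + 1 / T) ≤ (n : ℝ) ^ 3 * n := by gcongr
      _ = (n : ℝ) ^ 4 := by ring
  · have hRp : R ^ p n ≤ Real.exp (c * n) := by
      rw [← Real.exp_log hR0, ← Real.exp_nat_mul]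
      apply Real.exp_le_exp.2
      rw [div_mul_eq_mul_div, le_div_iff₀ (by positivity)] at hpn2
      have h1 : (p n : ℝ) * Real.log R ≤ p n * (|Real.log R| + 1) := by
        gcongr
        linarith [le_abs_self (Real.log R)]
      linarith
    have hexp : Real.exp (γ * (η * n) - γ / 8 * (Λmin ^ 2 * n) * ε ^ 2) ≤
        Real.exp (-(2 * c) * n) := by
      apply Real.exp_le_exp.2
      have h1 : γ * n * η ≤ γ * n * (Λmin ^ 2 * ε ^ 2 / 16) := by gcongr
      rw [hc]
      linarith
    have hk0 : 0 < k₂ - k₁ := by linarith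
    calc R ^ p n * Real.exp (γ * (η * n) - γ / 8 * (Λmin ^ 2 * n) * ε ^ 2) *
          ((k₂ - k₁) / (1 / (2 * ((n : ℝ) ^ 4) ^ 2)))
        ≤ Real.exp (c * n) * Real.exp (-(2 * c) * n) *
          ((k₂ - k₁) / (1 / (2 * ((n : ℝ) ^ 4) ^ 2))) := by gcongr
      _ = (k₂ - k₁) * 2 * ((n : ℝ) ^ 8 * Real.exp (-c * n)) := by
          rw [← Real.exp_add, div_div_eq_mul_div, div_one,
            show c * n + -(2 * c) * n = -c * n by ring]
          ring
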